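/- A (one-dimensional) stochastic cellular automaton (SCA) $\mathcal A=(Q,R,V,V',f)$ consists of non-empty finite sets $Q$ (states) and $R$ (random symbols), finite neighborhoods $V,V'\subset\mathbb Z$ and a local function $f:Q^{V}\times R^{V'}\to Q$. Its explicit global function is $F(c,s)_z=f\bigl((c_{z+v})_{v\in V},(s_{z+v'})_{v'\in V'}\bigr)$ for $c\in Q^{\mathbb Z}$, $s\in R^{\mathbb Z}$, and its stochastic global function $S_F$ maps $c\in Q^{\mathbb Z}$ to the law on $Q^{\mathbb Z}$ of $F(c,s)$, where $s\in R^{\mathbb Z}$ has independent uniformly distributed symbols. It is correlation-free if $V'=\{0\}$. Put $F^0(c)=c$ and $F^{t+1}(c,s^1,\dots,s^{t+1})=F(F^t(c,s^1,\dots,s^t),s^{t+1})$. For a map $g$ on symbols, also write $g$ for its cell-by-cell extension to configurations. For integers $m,t\ge 1$ and $z\in\mathbb Z$, the rescaling $\mathcal A^{\langle m,t,z\rangle}$ is the SCA with states $Q^m$, random symbols $(R^m)^t$ and explicit global function $(c,s)\mapsto b_m\circ\sigma_z\circ F^t\bigl(b_m^{-1}(c),b_m^{-1}(s^1),\dots,b_m^{-1}(s^t)\bigr)$,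 where $s^1,\dots,s^t$ are the components of $s$, $b_m(c)_x=(c_{mx},\dots,c_{mx+m-1})$ and $\sigma_z(c)_x=c_{x+z}$. If $i:Q'\to Q$ is injective and $F$ maps $i(Q')^{\mathbb Z}\times R^{\mathbb Z}$ into $i(Q')^{\mathbb Z}$, the $i$-restriction of $\mathcal A$ is the SCA with states $Q'$, random symbols $R$ and explicit global function $(c,s)\mapsto i^{-1}(F(i(c),s))$. If $\pi:Q\to Q'$ is onto and $\pi(c)=\pi(c')$ implies $\pi(F(c,s))=\pi(F(c',s))$ for all $s$, the $\pi$-projection of $\mathcal A$ is the SCA with states $Q'$, random symbols $R$ and explicit global function $(\pi(c),s)\mapsto\pi(F(c,s))$. Write $\mathcal A_1\preceq^S_i\mathcal A_2$ if there are $m_1,m_2,t_1,t_2\ge1$ and $z_1,z_2\in\mathbb Z$ such that $\mathcal A_1^{\langle m_1,t_1,z_1\rangle}$ has the same stochastic global function as some restriction of $\mathcal A_2^{\langle m_2,t_2,z_2\rangle}$, and $\mathcal A_1\preceq^S_m\mathcal A_2$ if the same holds with "some projection of some restriction" in place of "some restriction". **Theorem.** For every finite set $P$ of prime numbers there is a correlation-free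 SCA $\mathcal U_P$ such that for every SCA $\mathcal A$ with set of random symbols $R$: if all prime factors of $|R|$ belong to $P$, then $\mathcal A\preceq^S_i\mathcal U_P$ and $\mathcal A\preceq^S_m\mathcal U_P$. -/

import Mathlib

open MeasureTheory

/-- A (one-dimensional) stochastic cellular automaton with set of states `Q` and set of random
symbols `R` (both are required to be finite and non-empty wherever automata are quantified over):
two finite neighborhoods `V, V' ⊆ ℤ` and a local transition function `Q^V × R^V' → Q`. -/
structure SCA (Q R : Type*) where
  V : Finset ℤ
  V' : Finset ℤ
  f : (V → Q) → (V' → R) → Q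

namespace SCA

/-- The explicit global function
`F(c,s)_z = f((c_{z+v})_{v ∈ V}, (s_{z+v'})_{v' ∈ V'})`. -/
def global {Q R : Type*} (A : SCA Q R) (c : ℤ → Q) (s : ℤ → R) : ℤ → Q :=
  fun z => A.f (fun v => c (z + v)) (fun v' => s (z + v'))

/-- Each cell uses its own random symbol only. -/
def IsCorrelationFree {Q R : Type*} (A : SCA Q R) : Prop :=
  A.V' = {0}

/-- The iterates of the explicit global function:
`F^0(c) = c`, `F^{t+1}(c,s^1,…,s^{t+1}) = F(F^t(c,s^1,…,s^t), s^{t+1})`. -/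
def iter {Q R : Type*} (A : SCA Q R) : (t : ℕ) → (ℤ → Q) → (Fin t → ℤ → R) → ℤ → Q
  | 0, c, _ => c
  | t + 1, c, s => A.global (A.iter t c (fun i => s i.castSucc)) (s (Fin.last t))

section Stochastic

/-- The Borel σ-algebra of `S^ℤ` (product of the discrete ones). -/
abbrev confMS (S : Type*) : MeasurableSpace (ℤ → S) :=
  @MeasurableSpace.pi ℤ (fun _ => S) (fun _ => ⊤)

/-- The uniform measure `ν_S` on `S^ℤ`: the product of the uniform measures on `S`. -/
noncomputable def uniformConf (S : Type*) : @Measure (ℤ → S) (confMS S) :=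
  letI : MeasurableSpace S := ⊤
  Measure.infinitePi (fun _ : ℤ => ProbabilityTheory.uniformOn (Set.univ : Set S))

/-- The stochastic global function `Q^ℤ → M(Q^ℤ)`: the law of `F(c,s)` for `s` uniform. -/
noncomputable def stoc {Q R : Type*} (A : SCA Q R) (c : ℤ → Q) : @Measure (ℤ → Q) (confMS Q) :=
  @Measure.map _ _ (confMS R) (confMS Q) (A.global c) (uniformConf R)

/-- The push-forward in the definition of `stoc` is along a measurable map, so that it gives to an
event `E` the probability that `F(c,s) ∈ E`. -/
theorem measurable_global {Q R : Type*} [Finite R] (A : SCA Q R) (c : ℤ → Q) :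
    @Measurable _ _ (confMS R) (confMS Q) (A.global c) := by
  let : MeasurableSpace Q := ⊤
  let : MeasurableSpace R := ⊤
  have : DiscreteMeasurableSpace R := ⟨fun _ => trivial⟩
  refine measurable_pi_lambda _ fun z => ?_
  have h1 : Measurable (fun (s : ℤ → R) (v' : A.V') => s (z + v')) :=
    measurable_pi_lambda _ fun v' => measurable_pi_apply _
  exact (Measurable.of_discrete (f := A.f (fun v => c (z + v)))).comp h1

end Stochastic

section OfGlobal

/-- Extension of a pattern by an arbitrary symbol. -/
noncomputable def extendPattern {S : Type*} [Nonempty S] (W : Finset ℤ) (x : W → S) : ℤ → S :=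
  fun z => if h : z ∈ W then x ⟨z, h⟩ else Classical.arbitrary S

/-- The automaton with neighborhoods `V, V'` whose explicit global function is `G`; see
`global_ofGlobal`. -/
noncomputable def ofGlobal {Q R : Type*} [Nonempty Q] [Nonempty R] (V V' : Finset ℤ)
    (G : (ℤ → Q) → (ℤ → R) → ℤ → Q) : SCA Q R where
  V := V
  V' := V'
  f := fun x y => G (extendPattern V x) (extendPattern V' y) 0

/-- If `G` commutes with translations and the value of `G(c,s)` at `0` depends only on the
restrictions of `c` to `V` and of `s` to `V'`, then `G` is the explicit global function of
`ofGlobal V V' G`. -/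
theorem global_ofGlobal {Q R : Type*} [Nonempty Q] [Nonempty R] (V V' : Finset ℤ)
    (G : (ℤ → Q) → (ℤ → R) → ℤ → Q)
    (hshift : ∀ c s z, G c s z = G (fun x => c (z + x)) (fun x => s (z + x)) 0)
    (hloc : ∀ c d s r, (∀ v ∈ V, c v = d v) → (∀ v ∈ V', s v = r v) → G c s 0 = G d r 0) :
    (ofGlobal V V' G).global = G := by
  funext c s z
  rw [hshift]
  refine hloc _ _ _ _ (fun v hv => ?_) (fun v hv => ?_)
  · exact dif_pos (show v ∈ V from hv)
  · exact dif_pos (show v ∈ V' from hv)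

end OfGlobal

section Trimming

/-- `Y = i(Q')^ℤ` satisfies `F(Y, R^ℤ) ⊆ Y`. -/
def Stable {Q R Q' : Type*} (A : SCA Q R) (i : Q' → Q) : Prop :=
  ∀ (c : ℤ → Q) (s : ℤ → R), (∀ z, c z ∈ Set.range i) → ∀ z, A.global c s z ∈ Set.range i

/-- The `i`-restriction: same neighborhoods, and explicit global function
`I⁻¹ ∘ F(I(c), s)`, with `I` the cell-by-cell extension of `i`. It is meaningful when `i` is
injective and `Stable`; see `global_restriction`. -/
noncomputable def restriction {Q R Q' : Type*} [Nonempty Q'] [Nonempty R] (A : SCA Q R)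
    (i : Q' → Q) : SCA Q' R :=
  ofGlobal A.V A.V' (fun c s z => Function.invFun i (A.global (i ∘ c) s z))

theorem global_restriction {Q R Q' : Type*} [Nonempty Q'] [Nonempty R] (A : SCA Q R)
    (i : Q' → Q) (hi : A.Stable i) (c : ℤ → Q') (s : ℤ → R) :
    i ∘ (A.restriction i).global c s = A.global (i ∘ c) s := by
  have h : (A.restriction i).global =
      fun c s z => Function.invFun i (A.global (i ∘ c) s z) := by
    refine global_ofGlobal _ _ _ (fun c s z => by simp [global]) ?_
    intro c d s r hc hs
    simp only [global, zero_add, Function.comp]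
    congr 2
    · funext v; rw [hc v v.2]
    · funext v; rw [hs v v.2]
  rw [h]
  funext z
  exact Function.invFun_eq (hi (i ∘ c) s (fun z => ⟨c z, rfl⟩) z)

/-- `π` is `F`-compatible: `Π(c) = Π(c')` implies `Π(F(c,s)) = Π(F(c',s))`. -/
def Compatible {Q R Q' : Type*} (A : SCA Q R) (π : Q → Q') : Prop :=
  ∀ (c c' : ℤ → Q) (s : ℤ → R), π ∘ c = π ∘ c' → π ∘ A.global c s = π ∘ A.global c' s

/-- The `π`-projection, for `π` onto: same neighborhoods, and explicit global function
`(c', s) ↦ Π(F(c, s))`, with `c` a preimage of `c'` by the cell-by-cell extension `Π` of `π`.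
It is meaningful when `π` is `Compatible`; see `global_projection`. -/
noncomputable def projection {Q R Q' : Type*} [Nonempty Q'] [Nonempty R] (A : SCA Q R)
    (π : Q → Q') (hπ : Function.Surjective π) : SCA Q' R :=
  ofGlobal A.V A.V' (fun c' s => π ∘ A.global (Function.surjInv hπ ∘ c') s)

theorem global_projection {Q R Q' : Type*} [Nonempty Q'] [Nonempty R] (A : SCA Q R)
    (π : Q → Q') (hπ : Function.Surjective π) (hc : A.Compatible π) (c : ℤ → Q) (s : ℤ → R) :
    (A.projection π hπ).global (π ∘ c) s = π ∘ A.global c s := by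
  have h : (A.projection π hπ).global =
      fun c' s => π ∘ A.global (Function.surjInv hπ ∘ c') s := by
    refine global_ofGlobal _ _ _ (fun c s z => by simp [global]) ?_
    intro c d s r hc hs
    simp only [global, zero_add, Function.comp]
    congr 2
    · funext v; rw [hc v v.2]
    · funext v; rw [hs v v.2]
  rw [h]
  refine hc _ _ _ ?_
  funext z
  exact Function.surjInv_eq hπ _

/-- `A₁` is a stochastic subautomaton of `A₂`: it has the stochastic global function of some
`i`-restriction of `A₂`. -/
def StocSub {Q₁ R₁ Q₂ R₂ : Type*} [Nonempty Q₁] [Nonempty R₂]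
    (A₁ : SCA Q₁ R₁) (A₂ : SCA Q₂ R₂) : Prop :=
  ∃ i : Q₁ → Q₂, Function.Injective i ∧ A₂.Stable i ∧ A₁.stoc = (A₂.restriction i).stoc

/-- `A₁` has the stochastic global function of some `π`-projection of some `i`-restriction
of `A₂`. -/
def StocMix.{u} {Q₁ R₁ R₂ : Type*} {Q₂ : Type u} [Nonempty Q₁] [Nonempty R₂]
    (A₁ : SCA Q₁ R₁) (A₂ : SCA Q₂ R₂) : Prop :=
  ∃ (Q' : Type u) (_ : Nonempty Q') (i : Q' → Q₂) (π : Q' → Q₁) (hπ : Function.Surjective π),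
    Function.Injective i ∧ A₂.Stable i ∧ (A₂.restriction i).Compatible π ∧
      A₁.stoc = ((A₂.restriction i).projection π hπ).stoc

end Trimming

section Rescaling

/-- The packing map `b_m(c)_z = (c_{mz}, c_{mz+1}, …, c_{mz+m-1})`, a bijection from `S^ℤ`
to `(S^m)^ℤ`. -/
def pack (S : Type*) (m : ℕ+) : (ℤ → S) ≃ (ℤ → Fin m → S) where
  toFun c := fun z j => c (m * z + (j : ℕ))
  invFun d := fun x => d (x / m) ⟨(x % m).toNat, by
    have h1 := Int.emod_nonneg x (b := (m : ℕ)) (by simp)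
    have h2 := Int.emod_lt_of_pos x (b := (m : ℕ)) (by simp)
    omega⟩
  left_inv c := by
    funext x
    have h1 := Int.emod_nonneg x (b := (m : ℕ)) (by simp)
    simp only [Int.toNat_of_nonneg h1]
    rw [Int.mul_ediv_add_emod]
  right_inv d := by
    funext z j
    have hm : ((m : ℕ) : ℤ) ≠ 0 := by simp
    have hj : ((j : ℕ) : ℤ) < (m : ℕ) := by exact_mod_cast j.2
    have h1 : ((m : ℕ) * z + (j : ℕ) : ℤ) / (m : ℕ) = z := by
      rw [Int.add_comm, Int.add_mul_ediv_left _ _ hm, Int.ediv_eq_zero_of_lt (by omega) hj]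
      simp
    have h2 : ((m : ℕ) * z + (j : ℕ) : ℤ) % (m : ℕ) = (j : ℕ) := by
      rw [Int.add_comm, Int.add_mul_emod_self_left, Int.emod_eq_of_lt (by omega) hj]
    simp only [h1, h2, Int.toNat_natCast, Fin.eta]

/-- The translation `σ_z(c)_{z'} = c_{z'+z}`. -/
def shift {S : Type*} (z : ℤ) (c : ℤ → S) : ℤ → S := fun z' => c (z' + z)

/-- The neighborhood of `F^t` with respect to states. -/
def iterV {Q R : Type*} (A : SCA Q R) : ℕ → Finset ℤ
  | 0 => {0}
  | t + 1 => Finset.image₂ (· + ·) A.V (A.iterV t)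

/-- The neighborhood of `F^t` with respect to random symbols. -/
def iterV' {Q R : Type*} (A : SCA Q R) : ℕ → Finset ℤ
  | 0 => ∅
  | t + 1 => A.V' ∪ Finset.image₂ (· + ·) A.V (A.iterV' t)

/-- The indices of the blocks of size `m` that meet `{z, …, z + m - 1} + W`. -/
def blockNbhd (m : ℕ+) (z : ℤ) (W : Finset ℤ) : Finset ℤ :=
  Finset.image₂ (fun (j : ℕ) w => ((j : ℤ) + z + w) / m) (Finset.range m) W

/-- The explicit global function of the rescaling:
`b_m ∘ σ_z ∘ F^t(b_m⁻¹(c), b_m⁻¹(s^1), …, b_m⁻¹(s^t))`. -/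
def rescaledGlobal {Q R : Type*} (A : SCA Q R) (m t : ℕ+) (z : ℤ)
    (c : ℤ → Fin m → Q) (s : ℤ → Fin t → Fin m → R) : ℤ → Fin m → Q :=
  pack Q m (shift z (A.iter t ((pack Q m).symm c) (fun i => (pack R m).symm (fun j => s j i))))

/-- The rescaling `A^{m,t,z}`, with states `Q^m`, random symbols `(R^m)^t`, and explicit global
function `rescaledGlobal`; see `global_rescaling`. -/
noncomputable def rescaling {Q R : Type*} [Nonempty Q] [Nonempty R] (A : SCA Q R)
    (m t : ℕ+) (z : ℤ) : SCA (Fin m → Q) (Fin t → Fin m → R) :=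
  ofGlobal (blockNbhd m z (A.iterV t)) (blockNbhd m z (A.iterV' t)) (A.rescaledGlobal m t z)

theorem iter_shift {Q R : Type*} (A : SCA Q R) (t : ℕ) (a : ℤ) (c : ℤ → Q)
    (s : Fin t → ℤ → R) (x : ℤ) :
    A.iter t c s (a + x) = A.iter t (fun y => c (a + y)) (fun i y => s i (a + y)) x := by
  induction t generalizing x with
  | zero => rfl
  | succ t ih => simp only [iter, global, add_assoc, ih]

theorem iter_local {Q R : Type*} (A : SCA Q R) (t : ℕ) (c d : ℤ → Q) (s r : Fin t → ℤ → R)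
    (x : ℤ) (hc : ∀ v ∈ A.iterV t, c (x + v) = d (x + v))
    (hs : ∀ i, ∀ v ∈ A.iterV' t, s i (x + v) = r i (x + v)) :
    A.iter t c s x = A.iter t d r x := by
  induction t generalizing x with
  | zero => simpa [iter, iterV] using hc
  | succ t ih =>
    simp only [iter, global]
    congr 1
    · funext v
      refine ih _ _ _ (fun w hw => ?_) (fun i w hw => ?_)
      · rw [add_assoc]
        exact hc _ (Finset.mem_image₂_of_mem v.2 hw)
      · rw [add_assoc]
        exact hs _ _ (Finset.mem_union_right _ (Finset.mem_image₂_of_mem v.2 hw))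
    · funext v
      exact hs _ _ (Finset.mem_union_left _ v.2)

theorem pack_symm_shift {S : Type*} (m : ℕ+) (z : ℤ) (d : ℤ → Fin m → S) (x : ℤ) :
    (pack S m).symm d (m * z + x) = (pack S m).symm (fun y => d (z + y)) x := by
  have hm : ((m : ℕ) : ℤ) ≠ 0 := by simp
  have h1 : ((m : ℕ) * z + x) / (m : ℕ) = z + x / (m : ℕ) := by
    rw [add_comm, Int.add_mul_ediv_left _ _ hm, add_comm]
  have h2 : ((m : ℕ) * z + x) % (m : ℕ) = x % (m : ℕ) := by
    rw [add_comm, Int.add_mul_emod_self_left]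
  simp only [pack, Equiv.coe_fn_symm_mk, h1, h2]

theorem global_rescaling {Q R : Type*} [Nonempty Q] [Nonempty R] (A : SCA Q R)
    (m t : ℕ+) (z : ℤ) : (A.rescaling m t z).global = A.rescaledGlobal m t z := by
  refine global_ofGlobal _ _ _ (fun c s y => ?_) ?_
  · funext j
    simp only [rescaledGlobal, shift, pack, Equiv.coe_fn_mk, mul_zero, zero_add, add_assoc]
    rw [iter_shift]
    congr 1
    · funext x; exact pack_symm_shift m y c x
    · funext i x; exact pack_symm_shift m y (fun j => s j i) x
  · intro c d s r hc hs
    funext j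
    simp only [rescaledGlobal]
    show A.iter t _ _ _ = A.iter t _ _ _
    have hj : (j : ℕ) ∈ Finset.range (m : ℕ) := Finset.mem_range.2 j.2
    refine iter_local _ _ _ _ _ _ _ (fun v hv => ?_) (fun i v hv => ?_)
    · have := hc _ (Finset.mem_image₂_of_mem (f := fun (j : ℕ) w => ((j : ℤ) + z + w) / m) hj hv)
      simp only [pack, Equiv.coe_fn_symm_mk, mul_zero, zero_add]
      rw [this]
    · have := hs _ (Finset.mem_image₂_of_mem (f := fun (j : ℕ) w => ((j : ℤ) + z + w) / m) hj hv)
      simp only [pack, Equiv.coe_fn_symm_mk, mul_zero, zero_add]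
      rw [this]

end Rescaling

/-- The stochastic injective simulation pre-order (`A₂` simulates `A₁`). -/
def StocSimInj {Q₁ R₁ Q₂ R₂ : Type*} [Nonempty Q₁] [Nonempty R₁] [Nonempty Q₂] [Nonempty R₂]
    (A₁ : SCA Q₁ R₁) (A₂ : SCA Q₂ R₂) : Prop :=
  ∃ (m₁ m₂ t₁ t₂ : ℕ+) (z₁ z₂ : ℤ),
    StocSub (A₁.rescaling m₁ t₁ z₁) (A₂.rescaling m₂ t₂ z₂)

/-- The stochastic mixed simulation pre-order (`A₂` simulates `A₁`). -/
def StocSimMix {Q₁ R₁ Q₂ R₂ : Type*} [Nonempty Q₁] [Nonempty R₁] [Nonempty Q₂] [Nonempty R₂]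
    (A₁ : SCA Q₁ R₁) (A₂ : SCA Q₂ R₂) : Prop :=
  ∃ (m₁ m₂ t₁ t₂ : ℕ+) (z₁ z₂ : ℤ),
    StocMix (A₁.rescaling m₁ t₁ z₁) (A₂.rescaling m₂ t₂ z₂)

end SCA

/-!
A single automaton, the collider, is universal. Its cells hold an instruction that never changes,
and carry at most one particle moving to the right and at most one moving to the left, at unit
speed. When two particles arrive at a cell, the instruction of the cell rewrites their contents with
the help of the random symbol of the cell; otherwise they pass. As the contents range over a fixed
finite set, there are finitely many instructions, and all of them are allowed.

Let each block of cells carry a train of `k` right-moving particles at distance `2` from each other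
and a train of `J` left-moving particles at distance `2 * k` from each other. When the trains pass
each other, the `k * J` collisions take place in `k * J` different cells, in none of which any other
two particles meet (`SCA.IsTrains.run_le`). So the instruction of every single collision can be
prescribed, and passing trains perform an arbitrary circuit of the shape of a grid. In a period,
which is as long as a block, the right-moving train of a block meets the left-moving train of its
own block and then that of the block on its right. With the states written in unary, a circuit
can be chosen such that the state `X z` of block `z` and the message `Y z` that has reached it
become `h (X z) (Y z) r`, with a random symbol `r` drawn by the block, and `o (X (z + 1))`, for arbitrary
maps `h` and `o` (`SCA.Encodes.period`).

In such a dynamics every block can draw `l` symbols and then pass on what it knows to the left,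
until each block knows the states and symbols of its `w` neighbors on the right (`SCA.Gatherer`); in the
last step it applies an arbitrary local rule to them. An automaton with arbitrary neighborhoods has
this form after a translation (`SCA.stocSub_collider`). All symbols that are used are entries of the
array of symbols of the block at fixed distinct places. Hence they are independent and uniform.
When `|R|` divides `N ^ l`, a map with fibers of equal size makes a uniform element of `R` from `l`
uniform elements of `ZMod N`; and with `N` the product of the primes in `P`, such an `l` exists as
soon as all prime factors of `|R|` are in `P` (`SCA.dvd_prod_pow`). A restriction is also a
projection of a restriction, along a bijection (`SCA.StocSub.stocMix`).
-/

namespace SCA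

/-! ### The collider automaton -/

/-- The content of a moving particle: two bits and a symbol. -/
@[ext]
structure Signal (R : Type*) where
  main : Bool
  aux : Bool
  sym : R

/-- The instruction carried by an immobile cell: what becomes of a right-moving signal and of a
left-moving signal that meet there, given the random symbol of the cell. -/
abbrev Instr (R : Type*) : Type _ :=
  Signal R → Signal R → R → Signal R × Signal R

/-- A state of the collider: possibly a right-moving particle, possibly a left-moving particle, and
an instruction. -/
abbrev Cell (R : Type*) : Type _ :=
  Option (Signal R) × Option (Signal R) × Instr R

instance {R : Type*} [Finite R] : Finite (Signal R) :=
  Finite.of_injective (fun a : Signal R => (a.main, a.aux, a.sym)) fun a b h => by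
    simp only [Prod.mk.injEq] at h
    exact Signal.ext h.1 h.2.1 h.2.2

instance {R : Type*} [Nonempty R] : Nonempty (Signal R) :=
  ‹Nonempty R›.map fun r => ⟨false, false, r⟩

/-- The instruction acts when two particles meet; a lone particle passes unchanged. -/
def collide {R : Type*} : Option (Signal R) → Option (Signal R) → Instr R → R → Cell R
  | some d, some μ, g, r => (some (g d μ r).1, some (g d μ r).2, g)
  | d, μ, g, _ => (d, μ, g)

theorem collide_instr {R : Type*} (d μ : Option (Signal R)) (g : Instr R) (r : R) :
    (collide d μ g r).2.2 = g := by
  cases d <;> cases μ <;> rfl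

/-- The collider: right-moving particles arrive from the left, left-moving ones from the right,
instructions stay, and particles arriving at the same cell collide. -/
def collider (R : Type*) : SCA (Cell R) R where
  V := {-1, 0, 1}
  V' := {0}
  f c s := collide (c ⟨-1, by simp⟩).1 (c ⟨1, by simp⟩).2.1 (c ⟨0, by simp⟩).2.2 (s ⟨0, by simp⟩)

theorem collider_global {R : Type*} (c : ℤ → Cell R) (s : ℤ → R) (x : ℤ) :
    (collider R).global c s x = collide (c (x - 1)).1 (c (x + 1)).2.1 (c x).2.2 (s x) := by
  simp [global, collider, sub_eq_add_neg]

/-- The orbit of `c` when the symbols `s t` are used for the step from time `t` to `t + 1`. -/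
def run {Q R : Type*} (A : SCA Q R) (c : ℤ → Q) (s : ℕ → ℤ → R) : ℕ → ℤ → Q
  | 0 => c
  | t + 1 => A.global (run A c s t) (s t)

theorem iter_eq_run {Q R : Type*} (A : SCA Q R) (c : ℤ → Q) (s : ℕ → ℤ → R) (t : ℕ) :
    A.iter t c (fun i => s i) = A.run c s t := by
  induction t with
  | zero => rfl
  | succ t ih => simp only [iter, run, ← ih]; rfl

theorem run_add {Q R : Type*} (A : SCA Q R) (c : ℤ → Q) (s : ℕ → ℤ → R) (t u : ℕ) :
    A.run c s (t + u) = A.run (A.run c s t) (fun v => s (t + v)) u := by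
  induction u with
  | zero => rfl
  | succ u ih => rw [← add_assoc]; simp only [run, ih]

/-! ### Trains of particles -/

/-- `c` carries the program `w`, in every block `z` of length `2 * L` a train of `k` right-moving
particles `D z i` two cells apart, the first of them at `a` in the block, and a train of `J`
left-moving particles `M z j` with `1 ≤ j ≤ J`, spaced by `2 * k`, the `j`-th at `2 * k * j + b`;
and no other particle. -/
structure IsTrains {R : Type*} (k J L : ℕ) (w : ℤ → Instr R) (D M : ℤ → ℕ → Signal R) (a b : ℤ)
    (c : ℤ → Cell R) : Prop where
  instr : ∀ x, (c x).2.2 = w x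
  right : ∀ z i, i < k → (c (2 * L * z + 2 * (i : ℕ) + a)).1 = some (D z i)
  right_none : ∀ x, (∀ (z : ℤ) (i : ℕ), i < k → x ≠ 2 * L * z + 2 * i + a) → (c x).1 = none
  left : ∀ z j, 1 ≤ j → j ≤ J → (c (2 * L * z + 2 * k * (j : ℕ) + b)).2.1 = some (M z j)
  left_none : ∀ x, (∀ (z : ℤ) (j : ℕ), 1 ≤ j → j ≤ J → x ≠ 2 * L * z + 2 * k * j + b) →
    (c x).2.1 = none

namespace IsTrains

variable {R : Type*} {k J L : ℕ} {w : ℤ → Instr R} {D M D' M' : ℤ → ℕ → Signal R} {a b : ℤ}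
  {c c' : ℤ → Cell R}

theorem congr (h : IsTrains k J L w D M a b c) (hD : ∀ z i, i < k → D z i = D' z i)
    (hM : ∀ z j, 1 ≤ j → j ≤ J → M z j = M' z j) : IsTrains k J L w D' M' a b c where
  instr := h.instr
  right z i hi := by rw [h.right z i hi, hD z i hi]
  right_none := h.right_none
  left z j h1 h2 := by rw [h.left z j h1 h2, hM z j h1 h2]
  left_none := h.left_none

theorem unique (h : IsTrains k J L w D M a b c) (h' : IsTrains k J L w D M a b c') : c = c' := by
  funext x
  refine Prod.ext ?_ (Prod.ext ?_ ((h.instr x).trans (h'.instr x).symm))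
  · by_cases hx : ∃ (z : ℤ) (i : ℕ), i < k ∧ x = 2 * L * z + 2 * i + a
    · obtain ⟨z, i, hi, rfl⟩ := hx
      rw [h.right z i hi, h'.right z i hi]
    · push Not at hx
      rw [h.right_none x hx, h'.right_none x hx]
  · by_cases hx : ∃ (z : ℤ) (j : ℕ), 1 ≤ j ∧ j ≤ J ∧ x = 2 * L * z + 2 * k * j + b
    · obtain ⟨z, j, h1, h2, rfl⟩ := hx
      rw [h.left z j h1 h2, h'.left z j h1 h2]
    · push Not at hx
      rw [h.left_none x hx, h'.left_none x hx]

/-- Renumbering of the blocks to which the trains are attributed. -/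
theorem renumber (h : IsTrains k J L w D M a b c) (y y' : ℤ) :
    IsTrains k J L w (fun z => D (z - y)) (fun z => M (z - y')) (a - 2 * L * y) (b - 2 * L * y')
      c where
  instr := h.instr
  right z i hi := by rw [← h.right _ i hi]; congr 2; ring
  right_none x hx := h.right_none x fun z i hi e => hx (z + y) i hi (by rw [e]; ring)
  left z j h1 h2 := by rw [← h.left _ j h1 h2]; congr 3; ring
  left_none x hx := h.left_none x fun z j h1 h2 e => hx (z + y') j h1 h2 (by rw [e]; ring)

/-- A right-moving train meets the opposite left-moving train particle by particle. With `L` large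
enough, in `L` steps the particles `D z i` and `M z j` meet exactly once, at time `k * j - i` in
cell `2 * L * z + a + k * j + i`, and no other two particles meet. Consequently, if `d z i e` and
`μ z j i` are consistent with all these collisions, they tell the content of `D z i` after it has
met the first `e` left-moving particles, and that of `M z j` after it has met the right-moving
particles from `i` on. There is no left-moving particle `J + 1`, so `hd` says that nothing happens
at the time when it would be met. -/
theorem run_le (hk : 0 < k) (hL : L = k * (J + 1)) {d μ : ℤ → ℕ → ℕ → Signal R}
    {s : ℕ → ℤ → R}
    (hd : ∀ z i, i < k → d z i (J + 1) = d z i J)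
    (hg : ∀ z i e, i < k → e < J →
      w (2 * L * z + a + k * (e + 1) + i) (d z i e) (μ z (e + 1) (i + 1))
        (s (k * (e + 1) - i - 1) (2 * L * z + a + k * (e + 1) + i)) =
      (d z i (e + 1), μ z (e + 1) i))
    (h : IsTrains k J L w (fun z i => d z i 0) (fun z j => μ z j k) a a c) {t : ℕ} (ht : t ≤ L) :
    IsTrains k J L w (fun z i => d z i ((t + i) / k)) (fun z j => μ z j (min k (k * j - t)))
      (a + t) (a - t) ((collider R).run c s t) := by
  induction t with
  | zero =>
    simp only [run, Nat.cast_zero, add_zero, sub_zero, zero_add]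
    refine h.congr (fun z i hi => by rw [Nat.div_eq_of_lt hi]) (fun z j h1 h2 => ?_)
    rw [min_eq_left]
    exact Nat.le_mul_of_pos_right k h1
  | succ t ih =>
    have ih := ih (by omega)
    set C := (collider R).run c s t with hC
    -- two particles that arrive together belong to trains of the same block
    have meet : ∀ (z z' : ℤ) (i j : ℕ), i < k → 1 ≤ j → j ≤ J →
        2 * L * z + 2 * i + (a + t) + 2 = 2 * L * z' + 2 * k * j + (a - t) →
        z = z' ∧ t + 1 + i = k * j := by
      intro z z' i j hi h1 h2 e
      have e1 : ((t : ℤ) + 1) = L * (z' - z) + k * j - i := by linarith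
      have b1 : k * j + k ≤ L := by rw [hL]; nlinarith
      have b2 : k ≤ k * j := Nat.le_mul_of_pos_right k h1
      have b1' : (k : ℤ) * j + k ≤ L := by exact_mod_cast b1
      have b2' : (k : ℤ) ≤ k * j := by exact_mod_cast b2
      have hz : z' - z = 0 := by
        rcases lt_trichotomy (z' - z) 0 with hlt | h0 | hgt
        · exfalso
          have : (L : ℤ) * (z' - z) ≤ L * (-1) :=
            mul_le_mul_of_nonneg_left (by omega) (by positivity)
          omega
        · exact h0
        · exfalso
          have : (L : ℤ) * 1 ≤ L * (z' - z) :=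
            mul_le_mul_of_nonneg_left (by omega) (by positivity)
          omega
      rw [hz, mul_zero, zero_add] at e1
      refine ⟨by omega, ?_⟩
      have : ((t + 1 + i : ℕ) : ℤ) = (k * j : ℕ) := by push_cast; linarith
      exact_mod_cast this
    -- the outcome of the only possible kind of collision at time `t + 1`
    have hit : ∀ (z : ℤ) (i j : ℕ), i < k → 1 ≤ j → j ≤ J → t + 1 + i = k * j → ∀ x : ℤ,
        x = 2 * L * z + 2 * i + (a + t) + 1 →
        (collider R).global C (s t) x = (some (d z i j), some (μ z j i), w x) := by
      intro z i j hi h1 h2 hm x hx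
      obtain ⟨e, rfl⟩ : ∃ e, j = e + 1 := ⟨j - 1, by omega⟩
      have hm' : (t : ℤ) + 1 + i = k * (e + 1) := by exact_mod_cast hm
      have q1 : (C (x - 1)).1 = some (d z i e) := by
        have := ih.right z i hi
        rw [show x - 1 = 2 * L * z + 2 * (i : ℤ) + (a + t) by rw [hx]; ring, this]
        have : (t + i) / k = e := by
          rw [Nat.div_eq_iff hk]
          have : k * (e + 1) = e * k + k := by ring
          omega
        rw [this]
      have q2 : (C (x + 1)).2.1 = some (μ z (e + 1) (i + 1)) := by
        have := ih.left z (e + 1) h1 h2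
        rw [show x + 1 = 2 * L * z + 2 * k * ((e + 1 : ℕ) : ℤ) + (a - t) by
          rw [hx]; push_cast; linarith, this]
        have : min k (k * (e + 1) - t) = i + 1 := by omega
        rw [this]
      have q3 : x = 2 * L * z + a + k * (e + 1) + i := by rw [hx]; linarith
      have q4 : k * (e + 1) - i - 1 = t := by omega
      have := hg z i e hi (by omega)
      rw [q4, ← q3] at this
      rw [collider_global, q1, q2, ih.instr, collide, this]
    refine ⟨fun x => ?_, fun z i hi => ?_, fun x hx => ?_, fun z j h1 h2 => ?_, fun x hx => ?_⟩
    · rw [run, collider_global, collide_instr, ih.instr]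
    · rw [run]
      by_cases hm : ∃ j, 1 ≤ j ∧ j ≤ J ∧ t + 1 + i = k * j
      · obtain ⟨j, h1, h2, hm⟩ := hm
        rw [hit z i j hi h1 h2 hm _ (by push_cast; ring), hm, Nat.mul_div_cancel_left _ hk]
      · have q1 := ih.right z i hi
        have q2 : (C (2 * L * z + 2 * i + (a + (t + 1 : ℕ)) + 1)).2.1 = none := by
          refine ih.left_none _ fun z' j h1 h2 e => hm ⟨j, h1, h2, ?_⟩
          exact (meet z z' i j hi h1 h2 (by rw [← e]; push_cast; ring)).2
        -- the count of collisions changes only if it reaches the fictitious value `J + 1`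
        have q3 : d z i ((t + 1 + i) / k) = d z i ((t + i) / k) := by
          by_cases hdvd : k ∣ t + 1 + i
          · obtain ⟨j, hj⟩ := hdvd
            have hj1 : 1 ≤ j := by
              rcases Nat.eq_zero_or_pos j with rfl | h
              · simp at hj
              · exact h
            have hj2 : J < j := by
              by_contra hcon
              exact hm ⟨j, hj1, by omega, hj⟩
            have hj3 : j = J + 1 := by
              have : k * j < k * (J + 2) := by
                have : k * (J + 2) = k * (J + 1) + k := by ring
                omega
              have := Nat.lt_of_mul_lt_mul_left this
              omega
            subst hj3
            have : (t + i) / k = J := by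
              rw [Nat.div_eq_iff hk]
              have : k * (J + 1) = J * k + k := by ring
              omega
            rw [hj, Nat.mul_div_cancel_left _ hk, this, hd z i hi]
          · rw [add_right_comm] at hdvd ⊢
            rw [Nat.succ_div_of_not_dvd hdvd]
        rw [collider_global, q2,
          show (2 * L * z + 2 * (i : ℤ) + (a + (t + 1 : ℕ)) - 1 : ℤ) =
            2 * L * z + 2 * i + (a + t) by push_cast; ring, q1, collide, q3]
        simp
    · rw [run, collider_global, ih.right_none (x - 1) fun z i hi e => hx z i hi (by
        push_cast; linarith)]
      rfl
    · rw [run]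
      by_cases hm : ∃ i, i < k ∧ t + 1 + i = k * j
      · obtain ⟨i, hi, hm⟩ := hm
        have hm' : (t : ℤ) + 1 + i = k * j := by exact_mod_cast hm
        rw [hit z i j hi h1 h2 hm _ (by push_cast; linarith)]
        have : min k (k * j - (t + 1)) = i := by omega
        rw [this]
      · have q1 := ih.left z j h1 h2
        have q2 : (C (2 * L * z + 2 * k * j + (a - (t + 1 : ℕ)) - 1)).1 = none := by
          refine ih.right_none _ fun z' i hi e => hm ⟨i, hi, ?_⟩
          exact (meet z' z i j hi h1 h2 (by rw [← e]; push_cast; ring)).2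
        have q3 : min k (k * j - (t + 1)) = min k (k * j - t) := by
          by_contra hne
          exact hm ⟨k * j - (t + 1), by omega, by omega⟩
        rw [collider_global, q2,
          show (2 * L * z + 2 * k * (j : ℤ) + (a - (t + 1 : ℕ)) + 1 : ℤ) =
            2 * L * z + 2 * k * j + (a - t) by push_cast; ring, q1, collide, q3]
        simp
    · rw [run, collider_global, ih.left_none (x + 1) fun z j h1 h2 e => hx z j h1 h2 (by
        push_cast; linarith)]
      cases (C (x - 1)).1 <;> rfl

/-- The content of the trains once they have passed each other. -/
theorem run_eq (hk : 0 < k) (hL : L = k * (J + 1)) {d μ : ℤ → ℕ → ℕ → Signal R}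
    {s : ℕ → ℤ → R}
    (hd : ∀ z i, i < k → d z i (J + 1) = d z i J)
    (hg : ∀ z i e, i < k → e < J →
      w (2 * L * z + a + k * (e + 1) + i) (d z i e) (μ z (e + 1) (i + 1))
        (s (k * (e + 1) - i - 1) (2 * L * z + a + k * (e + 1) + i)) =
      (d z i (e + 1), μ z (e + 1) i))
    (h : IsTrains k J L w (fun z i => d z i 0) (fun z j => μ z j k) a a c) :
    IsTrains k J L w (fun z i => d z i J) (fun z j => μ z j 0) (a + L) (a - L)
      ((collider R).run c s L) := by
  refine (run_le hk hL hd hg h le_rfl).congr (fun z i hi => ?_) (fun z j h1 h2 => ?_)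
  · have : (L + i) / k = J + 1 := by
      rw [hL, Nat.mul_add_div hk, Nat.div_eq_of_lt hi, add_zero]
    rw [this, hd z i hi]
  · have : k * j ≤ L := by rw [hL]; exact Nat.mul_le_mul_left k (by omega)
    rw [Nat.sub_eq_zero_of_le this, Nat.min_zero]

end IsTrains

/-! ### The program -/

section Program

variable {R : Type*} (r₀ : R) (n : ℕ) (h : ℕ → ℕ → R → ℕ) (o : ℕ → ℕ)

/-- What happens in the first half of a period when the right-moving particle `i < n * n` meets the
left-moving particle `j`. The right-moving particle `i` stands for the pair `(i / n, i % n)`.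
The left-moving particle `1` distributes the random symbol drawn at its first collision; the
particle `υ + 2` brings the bit "the neighbor has sent `υ`" and takes away the bit
"`υ` is to be sent"; the particle `υ + n + 2` takes away the bit "`υ` is the new state". -/
def gate₁ (i j : ℕ) : Instr R := fun d μ s =>
  if j = 1 then
    if i + 1 = n * n then ({ d with sym := s }, { μ with sym := s })
    else ({ d with sym := μ.sym }, μ)
  else if j < n + 2 then
    (if i % n + 2 = j then { d with aux := μ.main } else d,
      if d.main then { μ with aux := decide (o (i / n) + 2 = j) } else μ)
  else
    (d, if d.main && d.aux then
      { μ with aux := decide (h (i / n) (i % n) d.sym + n + 2 = j) } else μ)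

/-- What happens in the second half of a period when the right-moving particle `i < n * n` meets
the left-moving particle `j`: the particle `j = υ + n + 2` delivers the bit "`υ` is the new state",
the particle `j = υ + 2` puts its outgoing bit in the place of the incoming one, and everything that
is no longer needed is erased. -/
def gate₂ (i j : ℕ) : Instr R := fun d μ _ =>
  if j = 1 then ({ d with aux := false, sym := r₀ }, { μ with sym := r₀ })
  else if j < n + 2 then
    (d, if i + 1 = n * n then { μ with main := μ.aux, aux := false } else μ)
  else
    (if i / n + n + 2 = j then { d with main := μ.aux } else d,
      if i = 0 then { μ with aux := false } else μ)

/-- Half the length of a block, for trains of `n * n` and `2 * n + 1` particles. -/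
def halfLength : ℕ := n * n * (2 * n + 1 + 1)

/-- The instructions of a block, repeated in all blocks. The right-moving particle `i` and the
left-moving particle `j` meet at distance `n * n * j + i` from the beginning of a half-block. -/
def program (x : ℤ) : Instr R :=
  let y := (x % (2 * halfLength n : ℕ)).toNat
  if y < halfLength n then gate₁ n h o (y % (n * n)) (y / (n * n))
  else gate₂ r₀ n ((y - halfLength n) % (n * n)) ((y - halfLength n) / (n * n))

/-- The right-moving train of a block in state `X`, in unary. -/
def stateTrain (X i : ℕ) : Signal R := ⟨decide (X = i / n), false, r₀⟩

/-- The left-moving train of a block to which its neighbor sends `Y`, in unary. -/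
def mailTrain (Y j : ℕ) : Signal R := ⟨decide (Y + 2 = j), false, r₀⟩

/-- The configuration `c` represents the states `X` and the messages `Y`. -/
abbrev Encodes (X Y : ℤ → ℕ) (c : ℤ → Cell R) : Prop :=
  IsTrains (n * n) (2 * n + 1) (halfLength n) (program r₀ n h o)
    (fun z => stateTrain r₀ n (X z)) (fun z => mailTrain r₀ (Y z)) 0 0 c

variable {r₀ n h o}

theorem program_add (z : ℤ) (y : ℕ) :
    program r₀ n h o (2 * halfLength n * z + y) = program r₀ n h o y := by
  unfold program
  rw [show (2 * (halfLength n : ℤ) * z + y) = y + ((2 * halfLength n : ℕ) : ℤ) * z by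
    push_cast; ring, Int.add_mul_emod_self_left]

theorem mul_add_lt_halfLength {i e : ℕ} (hi : i < n * n) (he : e < 2 * n + 1) :
    n * n * (e + 1) + i < halfLength n := by
  have : n * n * (e + 2) ≤ halfLength n := Nat.mul_le_mul_left _ (by omega)
  have : n * n * (e + 2) = n * n * (e + 1) + n * n := by ring
  omega

theorem program_first (z : ℤ) {i e : ℕ} (hi : i < n * n) (he : e < 2 * n + 1) :
    program r₀ n h o (2 * halfLength n * z + 0 + (n * n : ℕ) * (e + 1) + i) =
      gate₁ n h o i (e + 1) := by
  have h1 := mul_add_lt_halfLength hi he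
  have hk : 0 < n * n := by omega
  rw [show (2 * (halfLength n : ℤ) * z + 0 + (n * n : ℕ) * (e + 1) + i) =
    2 * halfLength n * z + (n * n * (e + 1) + i : ℕ) by push_cast; ring, program_add, program]
  have h2 : (((n * n * (e + 1) + i : ℕ) : ℤ) % (2 * halfLength n : ℕ)).toNat =
      n * n * (e + 1) + i := by
    rw [← Int.natCast_mod, Int.toNat_natCast, Nat.mod_eq_of_lt (by omega)]
  simp only [h2, if_pos h1]
  rw [Nat.mul_add_mod, Nat.mod_eq_of_lt hi, Nat.mul_add_div hk, Nat.div_eq_of_lt hi, add_zero]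

theorem program_second (z : ℤ) {i e : ℕ} (hi : i < n * n) (he : e < 2 * n + 1) :
    program r₀ n h o (2 * halfLength n * z + halfLength n + (n * n : ℕ) * (e + 1) + i) =
      gate₂ r₀ n i (e + 1) := by
  have h1 := mul_add_lt_halfLength hi he
  have hk : 0 < n * n := by omega
  rw [show (2 * (halfLength n : ℤ) * z + halfLength n + (n * n : ℕ) * (e + 1) + i) =
    2 * halfLength n * z + (halfLength n + (n * n * (e + 1) + i) : ℕ) by push_cast; ring,
    program_add, program]
  have h2 : (((halfLength n + (n * n * (e + 1) + i) : ℕ) : ℤ) % (2 * halfLength n : ℕ)).toNat =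
      halfLength n + (n * n * (e + 1) + i) := by
    rw [← Int.natCast_mod, Int.toNat_natCast, Nat.mod_eq_of_lt (by omega)]
  simp only [h2, if_neg (show ¬ halfLength n + (n * n * (e + 1) + i) < halfLength n by omega),
    Nat.add_sub_cancel_left]
  rw [Nat.mul_add_mod, Nat.mod_eq_of_lt hi, Nat.mul_add_div hk, Nat.div_eq_of_lt hi, add_zero]

end Program

/-! ### Collisions in one period -/

section Period

variable {R : Type*} (r₀ : R) (n : ℕ)

/-- The right-moving particle `i` of a block in state `X` with incoming message `Y`, after its first
`e` collisions in the first half of a period. -/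
def right₁ (X Y : ℕ) (r : R) (i e : ℕ) : Signal R :=
  ⟨decide (X = i / n), decide (i % n + 2 ≤ e ∧ Y = i % n), if 1 ≤ e then r else r₀⟩

/-- The left-moving particle `j` after it has met the right-moving particles from `i` on in the
first half of a period; the new state will be `X'`, the next message `Y'`. -/
def left₁ (X Y X' Y' : ℕ) (r : R) (j i : ℕ) : Signal R :=
  ⟨decide (Y + 2 = j),
    decide ((Y' + 2 = j ∧ i < (X + 1) * n) ∨ (X' + n + 2 = j ∧ i ≤ X * n + Y)),
    if j = 1 ∧ i < n * n then r else r₀⟩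

/-- The right-moving particle `i` after its first `e` collisions in the second half of a period. -/
def right₂ (X Y X' : ℕ) (r : R) (i e : ℕ) : Signal R :=
  ⟨if i / n + n + 2 ≤ e then decide (X' = i / n) else decide (X = i / n),
    decide (e = 0 ∧ Y = i % n), if 1 ≤ e then r₀ else r⟩

/-- The left-moving particle `j` after it has met the right-moving particles from `i` on in the
second half of a period. -/
def left₂ (Y X' Y' : ℕ) (r : R) (j i : ℕ) : Signal R :=
  ⟨if i < n * n then decide (Y' + 2 = j) else decide (Y + 2 = j),
    decide ((Y' + 2 = j ∧ i = n * n) ∨ (X' + n + 2 = j ∧ 0 < i)),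
    if j = 1 ∧ i = n * n then r else r₀⟩

variable {r₀ n} {h : ℕ → ℕ → R → ℕ} {o : ℕ → ℕ}

/-- The gates of the first half transform the contents as described by `right₁` and `left₁`. A
message bit is written only by right-moving particles of first component `X`, and a bit of the new
state only by the one of the pair `(X, Y)`, which alone has both bits set. -/
theorem gate₁_eq {X Y : ℕ} {r s : R} {i e : ℕ} (hX : X < n) (hY : Y < n) (ho : o X < n)
    (hi : i < n * n) (hs : e = 0 → i + 1 = n * n → s = r) :
    gate₁ n h o i (e + 1) (right₁ r₀ n X Y r i e)
      (left₁ r₀ n X Y (h X Y r) (o X) r (e + 1) (i + 1)) s =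
    (right₁ r₀ n X Y r i (e + 1), left₁ r₀ n X Y (h X Y r) (o X) r (e + 1) i) := by
  have hn : 0 < n := by omega
  have hm := Nat.mod_lt i hn
  have hlt : i / n < n := Nat.div_lt_of_lt_mul hi
  -- the right-moving particles whose first component is `X`
  have hfst : X = i / n ↔ X * n ≤ i ∧ i < (X + 1) * n := by
    rw [eq_comm, Nat.div_eq_iff hn]
    have : (X + 1) * n = X * n + n := by ring
    omega
  have hpair : X = i / n ∧ Y = i % n ↔ i = X * n + Y := by
    constructor
    · rintro ⟨h1, h2⟩
      rw [h1, h2, Nat.div_add_mod']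
    · rintro rfl
      rw [mul_comm X n, Nat.mul_add_div hn, Nat.div_eq_of_lt hY, Nat.mul_add_mod,
        Nat.mod_eq_of_lt hY]
      simp
  have hX1 : (X + 1) * n = X * n + n := by ring
  have hXn : (X + 1) * n ≤ n * n := Nat.mul_le_mul_right n hX
  unfold gate₁ right₁ left₁
  generalize X * n = a at *
  generalize (X + 1) * n = a' at *
  generalize n * n = k at *
  rcases Nat.lt_trichotomy e 0 with h0 | rfl | h0
  · omega
  · rw [if_pos rfl]
    split_ifs <;> simp only [Prod.mk.injEq, Signal.ext_iff, decide_eq_decide, true_and] <;> grind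
  · rw [if_neg (by omega)]
    by_cases h1 : e + 1 < n + 2
    · rw [if_pos h1]
      split_ifs <;> simp only [Prod.mk.injEq, Signal.ext_iff, decide_eq_decide, true_and] <;> grind
    · rw [if_neg h1]
      split_ifs <;> simp only [Prod.mk.injEq, Signal.ext_iff, decide_eq_decide, true_and] <;> grind

/-- The gates of the second half transform the contents as described by `right₂` and `left₂`. A
message bit is put in place at the first collision of its particle; a bit of the new state is erased
only at the last collision, after all deliveries. -/
theorem gate₂_eq {X Y Y₁ X' Y' : ℕ} {r r₁ s : R} {i e : ℕ} (hY : Y₁ < n) (hY' : Y' < n)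
    (hi : i < n * n) :
    gate₂ r₀ n i (e + 1) (right₂ r₀ n X Y X' r i e)
      (left₂ r₀ n Y₁ X' Y' r₁ (e + 1) (i + 1)) s =
    (right₂ r₀ n X Y X' r i (e + 1), left₂ r₀ n Y₁ X' Y' r₁ (e + 1) i) := by
  have hn : 0 < n := by omega
  have hlt : i / n < n := Nat.div_lt_of_lt_mul hi
  unfold gate₂ right₂ left₂
  rcases Nat.lt_trichotomy e 0 with h0 | rfl | h0
  · omega
  · rw [if_pos rfl]
    generalize n * n = k at *
    simp only [Prod.mk.injEq, Signal.ext_iff]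
    refine ⟨⟨?_, ?_, ?_⟩, ?_, ?_, ?_⟩ <;> grind
  · rw [if_neg (by omega)]
    by_cases h1 : e + 1 < n + 2
    · rw [if_pos h1]
      generalize n * n = k at *
      simp only [Prod.mk.injEq]
      refine ⟨?_, ?_⟩
      · rw [Signal.ext_iff]
        refine ⟨?_, ?_, ?_⟩ <;> grind
      · split_ifs <;> rw [Signal.ext_iff] <;> refine ⟨?_, ?_, ?_⟩ <;> grind
    · rw [if_neg h1]
      generalize n * n = k at *
      simp only [Prod.mk.injEq]
      refine ⟨?_, ?_⟩ <;> split_ifs <;> rw [Signal.ext_iff] <;> refine ⟨?_, ?_, ?_⟩ <;> grind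

/-- In one period a block in state `X z` with incoming message `Y z` goes to the state
`h (X z) (Y z) r`, where `r` is the symbol drawn in the block, and sends the message `o (X z)` to
its left neighbor. -/
theorem Encodes.period {X Y : ℤ → ℕ} {c : ℤ → Cell R} (hc : Encodes r₀ n h o X Y c)
    (s : ℕ → ℤ → R) (hX : ∀ z, X z < n) (hY : ∀ z, Y z < n) (ho : ∀ x < n, o x < n) :
    Encodes r₀ n h o
      (fun z => h (X z) (Y z) (s 0 (2 * halfLength n * z + (2 * (n * n) - 1 : ℕ))))
      (fun z => o (X (z + 1))) ((collider R).run c s (2 * halfLength n)) := by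
  have hn : 0 < n := (Nat.zero_le _).trans_lt (hX 0)
  have hk : 0 < n * n := Nat.mul_pos hn hn
  have hL : halfLength n = n * n * (2 * n + 1 + 1) := rfl
  set r : ℤ → R := fun z => s 0 (2 * halfLength n * z + (2 * (n * n) - 1 : ℕ)) with hr
  have h1 : IsTrains (n * n) (2 * n + 1) (halfLength n) (program r₀ n h o)
      (fun z i => right₁ r₀ n (X z) (Y z) (r z) i 0)
      (fun z j => left₁ r₀ n (X z) (Y z) (h (X z) (Y z) (r z)) (o (X z)) (r z) j (n * n))
      0 0 c := by
    refine hc.congr (fun z i hi => ?_) (fun z j h1 h2 => ?_)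
    · simp [stateTrain, right₁]
    · have : (X z + 1) * n ≤ n * n := Nat.mul_le_mul_right n (hX z)
      have : (X z + 1) * n = X z * n + n := by ring
      have := hY z
      simp only [mailTrain, left₁, Signal.ext_iff, true_and]
      constructor
      · symm
        rw [decide_eq_false_iff_not]
        omega
      · simp
  have h2 := h1.run_eq (d := fun z i e => right₁ r₀ n (X z) (Y z) (r z) i e)
    (μ := fun z j i => left₁ r₀ n (X z) (Y z) (h (X z) (Y z) (r z)) (o (X z)) (r z) j i)
    (s := s) hk hL (fun z i hi => by
      have := Nat.mod_lt i hn
      simp only [right₁, Signal.ext_iff, true_and]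
      constructor
      · generalize i % n = m at *
        rw [decide_eq_decide]
        omega
      · simp) (fun z i e hi he => by
      rw [program_first z hi he]
      refine gate₁_eq (hX z) (hY z) (ho _ (hX z)) hi fun h0 h1 => ?_
      -- the first of all collisions, at time `1`, is the one that draws the symbol
      subst h0
      simp only [hr]
      congr 1
      · omega
      · rw [show 2 * (n * n) - 1 = n * n + i by omega]
        push_cast
        ring)
  -- the left-moving trains have gone on to the block on the left
  have h3 := h2.renumber 0 (-1)
  have h4 : IsTrains (n * n) (2 * n + 1) (halfLength n) (program r₀ n h o)
      (fun z i => right₂ r₀ n (X z) (Y z) (h (X (z + 1)) (Y (z + 1)) (r (z + 1))) (r z) i 0)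
      (fun z j => left₂ r₀ n (Y (z + 1)) (h (X (z + 1)) (Y (z + 1)) (r (z + 1))) (o (X (z + 1)))
        (r (z + 1)) j (n * n)) (halfLength n) (halfLength n)
      ((collider R).run c s (halfLength n)) := by
    have e1 : (0 + (halfLength n : ℤ) - 2 * halfLength n * 0) = halfLength n := by ring
    have e2 : (0 - (halfLength n : ℤ) - 2 * halfLength n * (-1)) = halfLength n := by ring
    rw [e1, e2] at h3
    refine h3.congr (fun z i hi => ?_) (fun z j h1 h2 => ?_)
    · have := Nat.mod_lt i hn
      simp only [right₁, right₂, sub_zero, Signal.ext_iff]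
      generalize i % n = m at *
      refine ⟨?_, ?_, by simp⟩
      · simp
      · simp only [decide_eq_decide, true_and]
        omega
    · have := hX (z + 1)
      simp only [left₁, left₂, sub_neg_eq_add, Signal.ext_iff]
      refine ⟨by simp, ?_, by simp [hk]⟩
      have : 0 < (X (z + 1) + 1) * n := Nat.mul_pos (Nat.succ_pos _) hn
      rw [decide_eq_decide]; simp [hk, hn]
  have h5 := h4.run_eq (d := fun z i e =>
      right₂ r₀ n (X z) (Y z) (h (X (z + 1)) (Y (z + 1)) (r (z + 1))) (r z) i e)
    (μ := fun z j i => left₂ r₀ n (Y (z + 1)) (h (X (z + 1)) (Y (z + 1)) (r (z + 1)))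
      (o (X (z + 1))) (r (z + 1)) j i)
    (s := fun v => s (halfLength n + v)) hk hL (fun z i hi => by
      simp only [right₂, Signal.ext_iff]
      have : i / n < n := Nat.div_lt_of_lt_mul hi
      refine ⟨?_, by simp, by simp⟩
      rw [if_pos (by omega), if_pos (by omega)]) (fun z i e hi he => by
      rw [program_second z hi he]
      exact gate₂_eq (hY _) (ho _ (hX _)) hi)
  -- the right-moving trains have now reached the next block
  have h6 := h5.renumber 1 0
  rw [← run_add, show halfLength n + halfLength n = 2 * halfLength n from (two_mul _).symm] at h6
  have e1 : (halfLength n + (halfLength n : ℤ) - 2 * halfLength n * 1) = 0 := by ring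
  have e2 : (halfLength n - (halfLength n : ℤ) - 2 * halfLength n * 0) = 0 := by ring
  rw [e1, e2] at h6
  refine h6.congr (fun z i hi => ?_) (fun z j h1 h2 => ?_)
  · have : i / n < n := Nat.div_lt_of_lt_mul hi
    simp only [right₂, stateTrain, sub_add_cancel, Signal.ext_iff]
    refine ⟨by rw [if_pos (by omega)], by simp, by simp⟩
  · simp only [left₂, mailTrain, sub_zero, Signal.ext_iff]
    refine ⟨by simp [hk], by simp [hn.ne'], by simp [hn.ne']⟩

/-- The block that represents the state `X` and the message `Y`. -/
def block (r₀ : R) (n : ℕ) (h : ℕ → ℕ → R → ℕ) (o : ℕ → ℕ) (X Y p : ℕ) : Cell R :=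
  (if p % 2 = 0 ∧ p / 2 < n * n then some (stateTrain r₀ n X (p / 2)) else none,
    if p % (2 * (n * n)) = 0 ∧ 0 < p then some (mailTrain r₀ Y (p / (2 * (n * n)))) else none,
    program r₀ n h o p)

theorem pack_symm_apply {S : Type*} (m : ℕ+) (d : ℤ → Fin m → S) (z : ℤ) {p : ℕ}
    (hp : p < m) : (pack S m).symm d (m * z + p) = d z ⟨p, hp⟩ :=
  congrFun (congrFun ((pack S m).apply_symm_apply d) z) ⟨p, hp⟩

theorem encodes_block (hn : 0 < n) {m : ℕ+} (hm : (m : ℕ) = 2 * halfLength n) (X Y : ℤ → ℕ) :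
    Encodes r₀ n h o X Y
      ((pack _ m).symm fun z (p : Fin m) => block r₀ n h o (X z) (Y z) p) := by
  have hk : 0 < n * n := Nat.mul_pos hn hn
  have hm' : ((m : ℕ) : ℤ) = 2 * halfLength n := by exact_mod_cast hm
  have hL : 2 * halfLength n = 2 * (n * n) * (2 * n + 1) + 2 * (n * n) := by
    unfold halfLength; ring
  set c := (pack _ m).symm fun z (p : Fin m) => block r₀ n h o (X z) (Y z) p with hc
  have key : ∀ (z : ℤ) (p : ℕ), p < 2 * halfLength n →
      c (2 * halfLength n * z + p) = block r₀ n h o (X z) (Y z) p := fun z p hp => by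
    rw [← hm', hc, pack_symm_apply m _ z (hm ▸ hp)]
  have cover : ∀ x : ℤ, ∃ (z : ℤ) (p : ℕ), p < 2 * halfLength n ∧
      x = 2 * halfLength n * z + p := fun x => by
    have hpos : (0 : ℤ) < m := by exact_mod_cast m.pos
    have h0 := Int.emod_nonneg x hpos.ne'
    have h1 := Int.emod_lt_of_pos x hpos
    refine ⟨x / m, (x % m).toNat, by omega, ?_⟩
    rw [Int.toNat_of_nonneg h0, ← hm', Int.mul_ediv_add_emod]
  refine ⟨fun x => ?_, fun z i hi => ?_, fun x hx => ?_, fun z j h1 h2 => ?_, fun x hx => ?_⟩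
  · obtain ⟨z, p, hp, rfl⟩ := cover x
    rw [key z p hp, block, program_add]
  · have hi' : 2 * i < 2 * halfLength n := by nlinarith
    have := key z (2 * i) hi'
    push_cast at this
    rw [add_zero, this, block, if_pos ⟨by omega, by omega⟩]
    rw [show 2 * i / 2 = i by omega]
  · obtain ⟨z, p, hp, rfl⟩ := cover x
    rw [key z p hp, block]
    dsimp only
    rw [if_neg]
    rintro ⟨h1, h2⟩
    exact hx z (p / 2) h2 (by omega)
  · have hj' : 2 * (n * n) * j < 2 * halfLength n := by
      have : 2 * (n * n) * j ≤ 2 * (n * n) * (2 * n + 1) := Nat.mul_le_mul_left _ h2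
      omega
    have := key z (2 * (n * n) * j) hj'
    push_cast at this ⊢
    rw [add_zero, this, block]
    dsimp only
    rw [if_pos ⟨Nat.mul_mod_right _ _, Nat.mul_pos (by omega) h1⟩,
      Nat.mul_div_cancel_left _ (by omega)]
  · obtain ⟨z, p, hp, rfl⟩ := cover x
    rw [key z p hp, block]
    dsimp only
    rw [if_neg]
    rintro ⟨h1, h2⟩
    obtain ⟨j, rfl⟩ := Nat.dvd_of_mod_eq_zero h1
    refine hx z j (Nat.pos_of_mul_pos_left h2) ?_ (by push_cast; ring)
    have : 2 * (n * n) * (2 * n + 1) + 2 * (n * n) = 2 * (n * n) * (2 * n + 2) := by ring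
    rw [hL, this] at hp
    have := Nat.lt_of_mul_lt_mul_left hp
    omega

/-- The state can be read off a block: the bit of the right-moving particle `X * n` is set. -/
theorem block_injective (hn : 0 < n) {X X' Y Y' : ℕ} (hX : X < n)
    (hb : ∀ p < 2 * halfLength n, block r₀ n h o X Y p = block r₀ n h o X' Y' p) : X = X' := by
  have h1 : X * n < n * n := Nat.mul_lt_mul_of_pos_right hX hn
  have h2 : n * n ≤ halfLength n := Nat.le_mul_of_pos_right _ (by omega)
  have := congrArg Prod.fst (hb (2 * (X * n)) (by omega))
  simp only [block, Nat.mul_mod_right, Nat.mul_div_cancel_left _ (show 0 < 2 by omega), true_and,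
    if_pos h1, Option.some.injEq, stateTrain, Signal.ext_iff, Nat.mul_div_cancel _ hn,
    decide_true, and_true] at this
  exact (of_decide_eq_true this.symm).symm

end Period

/-! ### Gathering symbols and neighboring states -/

section Gather

variable {Q R : Type*} {l w : ℕ}

/-- A state of the gathering automaton: a clock, and what is known about the cells `0, …, w` to the
right: their states and the random symbols they have drawn. -/
abbrev Gatherer (Q R : Type*) (l w : ℕ) : Type _ :=
  Fin (l + 2 * w + 1) × (Fin (w + 1) → Q × (Fin l → R))

/-- The initial state of a cell that represents `q`. -/
def Gatherer.start (l w : ℕ) (r₀ : R) (q : Q) : Gatherer Q R l w :=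
  (0, fun _ => (q, fun _ => r₀))

/-- The new state of a cell in state `X` that has received `Y` and has drawn `r`. In the last step
the gathered information is used. -/
def Gatherer.next (r₀ : R) (φ : (Fin (w + 1) → Q × (Fin l → R)) → Q) (X Y : Gatherer Q R l w)
    (r : R) : Gatherer Q R l w :=
  if X.1 = Fin.last _ then Gatherer.start l w r₀ (φ X.2)
  else (X.1 + 1, Fin.cons ((X.2 0).1, fun j => if (j : ℕ) = X.1 then r else (X.2 0).2 j)
    fun a => Y.2 a.castSucc)

/-- The message of a cell in state `X` to its left neighbor. In the last step it is a fixed one. -/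
def Gatherer.send (r₀ : R) (q₀ : Q) (X : Gatherer Q R l w) : Gatherer Q R l w :=
  if X.1 = Fin.last _ then Gatherer.start l w r₀ q₀ else X

/-- The evolution of the states and of the incoming messages of all cells, where cell `z` draws the
symbol `ρ p z` in step `p`. A message arrives one step after it has been sent. -/
def Gatherer.orbit (r₀ : R) (q₀ : Q) (φ : (Fin (w + 1) → Q × (Fin l → R)) → Q) (q : ℤ → Q)
    (ρ : ℕ → ℤ → R) : ℕ → (ℤ → Gatherer Q R l w) × (ℤ → Gatherer Q R l w)
  | 0 => (fun z => Gatherer.start l w r₀ (q z), fun _ => Gatherer.start l w r₀ q₀)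
  | p + 1 =>
    let XY := orbit r₀ q₀ φ q ρ p
    (fun z => Gatherer.next r₀ φ (XY.1 z) (XY.2 z) (ρ p z),
      fun z => Gatherer.send r₀ q₀ (XY.1 (z + 1)))

variable (r₀ : R) (q₀ : Q) (φ : (Fin (w + 1) → Q × (Fin l → R)) → Q) (q : ℤ → Q)
  (ρ : ℕ → ℤ → R)

/-- As a message takes two steps per cell, what happens `a` cells to the right is known from time
`l + 2 * a` on. -/
theorem Gatherer.orbit_of_le (p : ℕ) (hp : p ≤ l + 2 * w) :
    (∀ z, (((Gatherer.orbit r₀ q₀ φ q ρ p).1 z).1 : ℕ) = p) ∧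
    (∀ z, (((Gatherer.orbit r₀ q₀ φ q ρ p).1 z).2 0).1 = q z) ∧
    (∀ z (j : Fin l), (j : ℕ) < p →
      (((Gatherer.orbit r₀ q₀ φ q ρ p).1 z).2 0).2 j = ρ j z) ∧
    (∀ z (a : Fin (w + 1)), l + 2 * a ≤ p →
      ((Gatherer.orbit r₀ q₀ φ q ρ p).1 z).2 a =
        (q (z + (a : ℕ)), fun j : Fin l => ρ j (z + (a : ℕ)))) ∧
    (∀ z (a : Fin (w + 1)), l + 2 * a + 1 ≤ p →
      ((Gatherer.orbit r₀ q₀ φ q ρ p).2 z).2 a =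
        (q (z + 1 + (a : ℕ)), fun j : Fin l => ρ j (z + 1 + (a : ℕ)))) := by
  induction p with
  | zero =>
    refine ⟨fun z => rfl, fun z => rfl, fun z j hj => absurd hj (by omega), fun z a ha => ?_,
      fun z a ha => absurd ha (by omega)⟩
    obtain rfl : l = 0 := by omega
    have : a = 0 := Fin.ext (by rw [Fin.val_zero]; omega)
    subst this
    simp only [orbit, start, Fin.val_zero, Nat.cast_zero, add_zero, Prod.mk.injEq, true_and]
    exact Subsingleton.elim _ _
  | succ p ih =>
    obtain ⟨i1, i2, i3, i4, i5⟩ := ih (by omega)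
    have hlast : ∀ z, ((orbit r₀ q₀ φ q ρ p).1 z).1 ≠ Fin.last _ := fun z h => by
      have := i1 z
      rw [h, Fin.val_last] at this
      omega
    have hX : ∀ z, (orbit r₀ q₀ φ q ρ (p + 1)).1 z =
        (((orbit r₀ q₀ φ q ρ p).1 z).1 + 1, Fin.cons ((((orbit r₀ q₀ φ q ρ p).1 z).2 0).1,
          fun j : Fin l => if (j : ℕ) = p then ρ p z else (((orbit r₀ q₀ φ q ρ p).1 z).2 0).2 j)
          fun a => ((orbit r₀ q₀ φ q ρ p).2 z).2 a.castSucc) := fun z => by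
      simp only [orbit, next, if_neg (hlast z), i1 z]
    have hY : ∀ z, (orbit r₀ q₀ φ q ρ (p + 1)).2 z = (orbit r₀ q₀ φ q ρ p).1 (z + 1) := fun z => by
      simp only [orbit, send, if_neg (hlast (z + 1))]
    have h3 : ∀ z (j : Fin l), (j : ℕ) < p + 1 →
        (((orbit r₀ q₀ φ q ρ (p + 1)).1 z).2 0).2 j = ρ j z := fun z j hj => by
      rw [hX]
      simp only [Fin.cons_zero]
      split_ifs with h
      · rw [h]
      · exact i3 z j (by omega)
    refine ⟨fun z => ?_, fun z => ?_, h3, fun z a ha => ?_, fun z a ha => ?_⟩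
    · rw [hX]
      simp only
      rw [Fin.val_add_one_of_lt' (by rw [i1]; omega), i1]
    · rw [hX]
      exact i2 z
    · cases a using Fin.cases with
      | zero =>
        refine Prod.ext ?_ (funext fun j => ?_)
        · rw [hX]
          simpa using i2 z
        · rw [h3 z j (by have := j.2; omega)]
          simp
      | succ a =>
        rw [hX]
        simp only [Fin.cons_succ]
        rw [i5 z a.castSucc (by simp at ha ⊢; omega)]
        have : z + 1 + ((a.castSucc : Fin (w + 1)) : ℕ) = z + (a.succ : Fin (w + 1)) := by
          simp; ring
        rw [this]
    · rw [hY]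
      exact i4 (z + 1) a (by omega)

theorem Gatherer.orbit_last :
    Gatherer.orbit r₀ q₀ φ q ρ (l + 2 * w + 1) =
      (fun z => Gatherer.start l w r₀
        (φ fun a : Fin (w + 1) => (q (z + (a : ℕ)), fun j : Fin l => ρ j (z + (a : ℕ)))),
        fun _ => Gatherer.start l w r₀ q₀) := by
  obtain ⟨i1, -, -, i4, -⟩ := Gatherer.orbit_of_le r₀ q₀ φ q ρ (l + 2 * w) le_rfl
  have hlast : ∀ z, ((orbit r₀ q₀ φ q ρ (l + 2 * w)).1 z).1 = Fin.last _ :=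
    fun z => Fin.ext (by rw [i1 z, Fin.val_last])
  have h2 : ∀ z, ((orbit r₀ q₀ φ q ρ (l + 2 * w)).1 z).2 =
      fun a : Fin (w + 1) => (q (z + (a : ℕ)), fun j : Fin l => ρ j (z + (a : ℕ))) := fun z => by
    funext a
    exact i4 z a (by have := a.2; omega)
  simp only [orbit, next, send, hlast, if_true, h2]

end Gather

/-! ### The collider simulates the gathering automaton -/

section Simulation

variable {S R : Type*} [Finite S]

/-- A numbering of a finite set. -/
noncomputable def code (x : S) : ℕ :=
  Finite.equivFin S x

theorem code_lt (x : S) : code x < Nat.card S :=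
  (Finite.equivFin S x).2

theorem code_injective : Function.Injective (code : S → ℕ) := fun _ _ h =>
  (Finite.equivFin S).injective (Fin.ext h)

variable [Nonempty S]

/-- The inverse of the numbering, with arbitrary values at other numbers. -/
noncomputable def decode : ℕ → S :=
  Function.invFun code

theorem decode_code (x : S) : decode (code x) = x :=
  Function.leftInverse_invFun code_injective x

/-- The collider iterates an arbitrary map of states and messages, transported to numbers. -/
theorem encodes_run {r₀ : R} (H : S → S → R → S) (O : S → S) {X Y : ℕ → ℤ → S}
    {c : ℤ → Cell R} {s : ℕ → ℤ → R} {n : ℕ} (hn : n = Nat.card S)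
    (hX : ∀ p z, X (p + 1) z = H (X p z) (Y p z)
      (s (p * (2 * halfLength n)) (2 * halfLength n * z + (2 * (n * n) - 1 : ℕ))))
    (hY : ∀ p z, Y (p + 1) z = O (X p (z + 1)))
    (hc : Encodes r₀ n (fun x y r => code (H (decode x) (decode y) r))
      (fun x => code (O (decode x))) (fun z => code (X 0 z)) (fun z => code (Y 0 z)) c) (p : ℕ) :
    Encodes r₀ n (fun x y r => code (H (decode x) (decode y) r)) (fun x => code (O (decode x)))
      (fun z => code (X p z)) (fun z => code (Y p z))
      ((collider R).run c s (p * (2 * halfLength n))) := by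
  subst hn
  induction p with
  | zero => simpa only [Nat.zero_mul, run] using hc
  | succ p ih =>
    have := ih.period (fun v => s (p * (2 * halfLength (Nat.card S)) + v)) (fun z => code_lt _)
      (fun z => code_lt _) fun x _ => code_lt _
    rw [← run_add, ← Nat.succ_mul] at this
    simpa only [decode_code, add_zero, ← hX, ← hY] using this

/-- Some rescaling of the collider has a restriction in which cell `z` applies an arbitrary map to
the states of the cells `z, …, z + w` and to `l` of the random symbols in each of them. -/
theorem exists_collider_simulation {Q R : Type*} [Finite Q] [Nonempty Q] [Finite R] [Nonempty R]
    {l w : ℕ} (φ : (Fin (w + 1) → Q × (Fin l → R)) → Q) :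
    ∃ (m t : ℕ+) (i : Q → Fin m → Cell R) (κ : Fin l → Fin t × Fin m),
      Function.Injective i ∧ Function.Injective κ ∧
      ∀ (q : ℤ → Q) (s : ℤ → Fin t → Fin m → R),
        ((collider R).rescaling m t 0).global (i ∘ q) s =
          i ∘ fun z => φ fun a => (q (z + (a : ℕ)), fun j => s (z + (a : ℕ)) (κ j).1 (κ j).2) := by
  obtain ⟨r₀⟩ := ‹Nonempty R›
  obtain ⟨q₀⟩ := ‹Nonempty Q›
  have : Nonempty (Gatherer Q R l w) := ⟨Gatherer.start l w r₀ q₀⟩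
  obtain ⟨n, hn⟩ : ∃ n, n = Nat.card (Gatherer Q R l w) := ⟨_, rfl⟩
  have hn0 : 0 < n := hn ▸ Nat.card_pos
  have hk : 0 < n * n := Nat.mul_pos hn0 hn0
  have hkL : n * n ≤ halfLength n := Nat.le_mul_of_pos_right _ (by omega)
  let H : Gatherer Q R l w → Gatherer Q R l w → R → Gatherer Q R l w := Gatherer.next r₀ φ
  let O : Gatherer Q R l w → Gatherer Q R l w := Gatherer.send r₀ q₀
  let h : ℕ → ℕ → R → ℕ := fun x y r => code (H (decode x) (decode y) r)
  let o : ℕ → ℕ := fun x => code (O (decode x))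
  let m : ℕ+ := ⟨2 * halfLength n, by omega⟩
  let t : ℕ+ := ⟨(l + 2 * w + 1) * (2 * halfLength n), Nat.mul_pos (by omega) (by omega)⟩
  let i : Q → Fin m → Cell R := fun q p => block r₀ n h o
    (code (Gatherer.start l w r₀ q)) (code (Gatherer.start l w r₀ q₀)) p
  have hlt : ∀ j : Fin l, (j : ℕ) * (2 * halfLength n) < t := fun j =>
    Nat.mul_lt_mul_of_pos_right (by have := j.2; omega) (by omega)
  have hpos : 2 * (n * n) - 1 < (m : ℕ) := show _ < 2 * halfLength n by omega
  refine ⟨m, t, i, fun j => (⟨j * (2 * halfLength n), hlt j⟩, ⟨2 * (n * n) - 1, hpos⟩),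
    fun q q' e => ?_, fun j j' e => ?_, fun q s => ?_⟩
  · have := block_injective hn0 (hn ▸ code_lt _) fun p hp => congrFun e ⟨p, hp⟩
    have := congrArg (fun X : Gatherer Q R l w => (X.2 0).1) (code_injective this)
    exact this
  · have := congrArg (fun x => (x.1 : ℕ)) e
    exact Fin.ext (Nat.eq_of_mul_eq_mul_right (by omega) this)
  · -- the symbols of the blocks, extended beyond the time at which the simulation ends
    let s' : ℕ → ℤ → R := fun v =>
      if hv : v < t then (pack R m).symm fun z => s z ⟨v, hv⟩ else fun _ => r₀
    have hs' : ∀ (j : Fin l) (z : ℤ),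
        s' (j * (2 * halfLength n)) (2 * halfLength n * z + (2 * (n * n) - 1 : ℕ)) =
          s z ⟨j * (2 * halfLength n), hlt j⟩ ⟨2 * (n * n) - 1, hpos⟩ := fun j z => by
      simp only [s', dif_pos (hlt j)]
      have := pack_symm_apply m (fun z => s z ⟨j * (2 * halfLength n), hlt j⟩) z hpos
      rw [← this]
      congr 1
    let ρ : ℕ → ℤ → R := fun p z =>
      s' (p * (2 * halfLength n)) (2 * halfLength n * z + (2 * (n * n) - 1 : ℕ))
    have h0 := encodes_block (r₀ := r₀) (h := h) (o := o) hn0 (m := m) rfl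
      (fun z => code (Gatherer.start l w r₀ (q z))) (fun _ => code (Gatherer.start l w r₀ q₀))
    have h1 := encodes_run H O (X := fun p => (Gatherer.orbit r₀ q₀ φ q ρ p).1)
      (Y := fun p => (Gatherer.orbit r₀ q₀ φ q ρ p).2) (s := s') hn (fun p z => rfl)
      (fun p z => rfl) h0 (l + 2 * w + 1)
    rw [Gatherer.orbit_last] at h1
    have h2 := h1.unique (encodes_block (m := m) hn0 rfl _ _)
    have h3 : (fun v : Fin t => s' v) = fun v => (pack R m).symm fun z => s z v := by
      funext v
      simp only [s', dif_pos v.2, Fin.eta]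
    rw [← iter_eq_run] at h2
    rw [global_rescaling]
    unfold rescaledGlobal
    rw [← h3]
    have h4 : ∀ c : ℤ → Cell R, shift 0 c = c := fun c => by
      funext x
      simp [shift]
    rw [h4]
    refine (congrArg (pack (Cell R) m) h2).trans ?_
    rw [Equiv.apply_symm_apply]
    funext z
    simp only [Function.comp, i]
    simp only [ρ, hs']
    rfl

end Simulation

/-! ### Uniform measures -/

section Uniform

/-- The image of the uniform measure on `S` is the uniform measure on `S'`. -/
def PreservesUniform {S S' : Type*} (f : S → S') : Prop :=
  @Measure.map S S' ⊤ ⊤ f (@ProbabilityTheory.uniformOn S ⊤ Set.univ) =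
    @ProbabilityTheory.uniformOn S' ⊤ Set.univ

theorem PreservesUniform.comp {S S' S'' : Type*} {g : S' → S''} {f : S → S'}
    (hg : PreservesUniform g) (hf : PreservesUniform f) : PreservesUniform (g ∘ f) := by
  let : MeasurableSpace S := ⊤
  let : MeasurableSpace S' := ⊤
  let : MeasurableSpace S'' := ⊤
  unfold PreservesUniform at *
  rw [← Measure.map_map measurable_from_top measurable_from_top, hf, hg]

theorem preservesUniform_of_card_fiber {S S' : Type*} [Finite S] [Nonempty S] [Finite S']
    {f : S → S'} {k : ℕ} (hf : ∀ y, Nat.card {x // f x = y} = k) : PreservesUniform f := by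
  classical
  have := Fintype.ofFinite S
  have := Fintype.ofFinite S'
  let : MeasurableSpace S := ⊤
  let : MeasurableSpace S' := ⊤
  have : DiscreteMeasurableSpace S := ⟨fun _ => trivial⟩
  have : DiscreteMeasurableSpace S' := ⟨fun _ => trivial⟩
  have hcard : Fintype.card S = Fintype.card S' * k := by
    rw [← Nat.card_eq_fintype_card, Nat.card_congr (Equiv.sigmaFiberEquiv f).symm, Nat.card_sigma,
      Finset.sum_congr rfl fun y _ => hf y]
    simp
  have hS : Fintype.card S ≠ 0 := Fintype.card_ne_zero
  have hk : k ≠ 0 := fun h => hS (by rw [hcard, h, mul_zero])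
  refine Measure.ext_of_singleton fun y => ?_
  have h1 : Measure.count (f ⁻¹' {y}) = k := by
    rw [← hf y, Measure.count_apply_finite _ (Set.toFinite _), ← Set.ncard_eq_toFinset_card]
    rfl
  rw [Measure.map_apply measurable_from_top .of_discrete, ProbabilityTheory.uniformOn_univ,
    ProbabilityTheory.uniformOn_univ, h1, Measure.count_singleton, hcard]
  push_cast
  have hk' : (k : ENNReal) ≠ 0 := by exact_mod_cast hk
  simpa using ENNReal.mul_div_mul_right 1 (Fintype.card S' : ENNReal) hk' (ENNReal.natCast_ne_top k)

theorem preservesUniform_of_surjective {G H : Type*} [AddGroup G] [AddGroup H] [Finite G]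
    (f : G →+ H) (hf : Function.Surjective f) : PreservesUniform f := by
  classical
  have := Fintype.ofFinite G
  have : Finite H := Finite.of_surjective f hf
  refine preservesUniform_of_card_fiber (k := Nat.card {x // f x = 0}) fun y => ?_
  simp only [Nat.card_eq_fintype_card, Fintype.card_subtype]
  exact AddMonoidHom.card_fiber_eq_of_mem_range f (hf y) (hf 0)

/-- Distinct entries of a uniform random array are uniform. -/
theorem preservesUniform_entries {G ι κ ν : Type*} [AddGroup G] [Finite G] [Finite ι] [Finite κ]
    {e : ν → ι × κ} (he : Function.Injective e) :
    PreservesUniform fun (x : ι → κ → G) (j : ν) => x (e j).1 (e j).2 := by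
  let f : (ι → κ → G) →+ (ν → G) :=
    { toFun := fun x j => x (e j).1 (e j).2
      map_zero' := rfl
      map_add' := fun _ _ => rfl }
  refine preservesUniform_of_surjective f fun y => ?_
  refine ⟨fun a b => Function.extend e y 0 (a, b), funext fun j => ?_⟩
  exact he.extend_apply y 0 j

/-- If the cardinality of `S'` divides that of `S`, some map `S → S'` has fibers of equal size. -/
theorem exists_preservesUniform {S S' : Type*} [Finite S] [Nonempty S] [Finite S']
    [Nonempty S'] (h : Nat.card S' ∣ Nat.card S) : ∃ f : S → S', PreservesUniform f := by
  obtain ⟨k, hk⟩ := h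
  have e : S ≃ S' × Fin k := (Finite.card_eq.1 (by simpa using hk)).some
  refine ⟨fun x => (e x).1, preservesUniform_of_card_fiber (k := k) fun y => ?_⟩
  rw [Nat.card_congr (e.subtypeEquiv (q := fun p => p.1 = y) fun x => Iff.rfl)]
  have e' : {p : S' × Fin k // p.1 = y} ≃ Fin k :=
    { toFun := fun p => p.1.2
      invFun := fun a => ⟨(y, a), rfl⟩
      left_inv := fun ⟨⟨a, b⟩, h⟩ => Subtype.ext (Prod.ext h.symm rfl)
      right_inv := fun _ => rfl }
  rw [Nat.card_congr e', Nat.card_fin]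

theorem preservesUniform_of_bijective {S S' : Type*} [Finite S] [Nonempty S] [Finite S']
    {f : S → S'} (hf : Function.Bijective f) : PreservesUniform f := by
  refine preservesUniform_of_card_fiber (k := 1) fun y => ?_
  rw [Nat.card_eq_one_iff_exists]
  obtain ⟨x, hx⟩ := hf.2 y
  exact ⟨⟨x, hx⟩, fun x' => Subtype.ext (hf.1 (x'.2.trans hx.symm))⟩

/-- The cell-by-cell extension of a map that preserves uniform measures does so too. -/
theorem map_uniformConf {S S' : Type*} [Finite S] [Nonempty S] [Finite S'] [Nonempty S']
    {f : S → S'} (hf : PreservesUniform f) :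
    @Measure.map _ _ (confMS S) (confMS S') (fun s z => f (s z)) (uniformConf S) =
      uniformConf S' := by
  let : MeasurableSpace S := ⊤
  let : MeasurableSpace S' := ⊤
  have : IsProbabilityMeasure (ProbabilityTheory.uniformOn (Set.univ : Set S)) :=
    ProbabilityTheory.isProbabilityMeasure_uniformOn Set.finite_univ Set.univ_nonempty
  unfold uniformConf
  rw [Measure.infinitePi_map_pi _ fun _ => measurable_from_top]
  congr 1
  funext z
  exact hf

end Uniform

/-! ### Universality of the collider -/

section Simulates

variable {Q₁ R₁ R₂ : Type*} [Nonempty Q₁] [Nonempty R₂]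

/-- It suffices to simulate the explicit global function, up to a change of the random symbols
that preserves their distribution. -/
theorem stocSub_of_global_eq {Q₂ : Type*} [Finite R₁] [Nonempty R₁] [Finite R₂] {A₁ : SCA Q₁ R₁}
    {A₂ : SCA Q₂ R₂} {i : Q₁ → Q₂} (hi : Function.Injective i) {θ : R₂ → R₁}
    (hθ : PreservesUniform θ)
    (h : ∀ q s, A₂.global (i ∘ q) s = i ∘ A₁.global q fun z => θ (s z)) : StocSub A₁ A₂ := by
  have hst : A₂.Stable i := fun c s hc z => by
    choose q hq using hc
    obtain rfl : i ∘ q = c := funext hq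
    exact ⟨A₁.global q (fun z => θ (s z)) z, by rw [h]; rfl⟩
  refine ⟨i, hi, hst, funext fun q => ?_⟩
  have hg : (A₂.restriction i).global q = A₁.global q ∘ fun s z => θ (s z) := funext fun s =>
    hi.comp_left ((A₂.global_restriction i hst q s).trans (h q s))
  let : MeasurableSpace Q₁ := ⊤
  let : MeasurableSpace R₁ := ⊤
  let : MeasurableSpace R₂ := ⊤
  have hm : Measurable fun (s : ℤ → R₂) z => θ (s z) :=
    measurable_pi_lambda _ fun z => measurable_from_top.comp (measurable_pi_apply z)
  unfold stoc
  rw [hg, ← map_uniformConf hθ]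
  exact Measure.map_map (A₁.measurable_global q) hm

/-- A restriction along `i` is a projection, along a bijection, of the restriction to the range
of `i`. -/
theorem StocSub.stocMix {Q₂ : Type*} {A₁ : SCA Q₁ R₁} {A₂ : SCA Q₂ R₂} (h : StocSub A₁ A₂) :
    StocMix A₁ A₂ := by
  obtain ⟨i, hi, hst, heq⟩ := h
  let e : Q₁ ≃ Set.range i := Equiv.ofInjective i hi
  have hne : Nonempty (Set.range i) := e.nonempty_congr.1 ‹_›
  have hst' : A₂.Stable (Subtype.val : Set.range i → Q₂) := fun c s hc z => by
    rw [Subtype.range_val] at hc ⊢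
    exact hst c s hc z
  have hcomp : (A₂.restriction (Subtype.val : Set.range i → Q₂)).Compatible e.symm :=
    fun c c' s hcc => by rw [e.symm.injective.comp_left hcc]
  refine ⟨Set.range i, hne, Subtype.val, e.symm, e.symm.surjective, Subtype.val_injective, hst',
    hcomp, heq.trans ?_⟩
  have hg : (A₂.restriction i).global =
      ((A₂.restriction (Subtype.val : Set.range i → Q₂)).projection e.symm
        e.symm.surjective).global := by
    funext q s
    have h1 := global_projection _ e.symm e.symm.surjective hcomp (e ∘ q) s
    rw [← Function.comp_assoc, e.symm_comp_self, Function.id_comp] at h1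
    refine h1.symm ▸ hi.comp_left ?_
    have h2 := A₂.global_restriction (Subtype.val : Set.range i → Q₂) hst' (e ∘ q) s
    have h3 : i ∘ e.symm = Subtype.val := funext fun x => by
      have := congrArg Subtype.val (e.apply_symm_apply x)
      exact this
    change i ∘ _ = i ∘ e.symm ∘ _
    rw [A₂.global_restriction i hst, ← Function.comp_assoc, h3, h2]
    rfl
  unfold stoc
  rw [hg]

end Simulates

theorem pack_one_symm {S : Type*} (d : ℤ → Fin (1 : ℕ+) → S) :
    (pack S 1).symm d = fun x => d x 0 :=
  (Equiv.symm_apply_eq _).2 (by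
    funext x j
    obtain rfl : j = 0 := Subsingleton.elim (α := Fin 1) _ _
    change d x 0 = d (((1 : ℕ+) : ℕ) * x + ((0 : ℕ) : ℤ)) 0
    simp)

theorem rescaling_one_global {Q R : Type*} [Nonempty Q] [Nonempty R] (A : SCA Q R) (b : ℤ)
    (q : ℤ → Fin (1 : ℕ+) → Q) (s : ℤ → Fin (1 : ℕ+) → Fin (1 : ℕ+) → R) (z : ℤ) :
    (A.rescaling 1 1 b).global q s z =
      fun _ => A.f (fun v => q (z + (b + v)) 0) (fun v' => s (z + (b + v')) 0 0) := by
  rw [global_rescaling]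
  funext j
  obtain rfl : j = 0 := Subsingleton.elim (α := Fin 1) _ _
  change A.global ((pack Q 1).symm q) ((pack R 1).symm fun j => s j 0)
    (((1 : ℕ+) : ℕ) * z + ((0 : ℕ) : ℤ) + b) = _
  rw [pack_one_symm, pack_one_symm]
  simp [global, add_assoc]

theorem dvd_prod_pow {P : Finset ℕ} {n : ℕ} (hn : n ≠ 0) (h : n.primeFactors ⊆ P) :
    n ∣ (∏ p ∈ P, p) ^ n := by
  calc n = ∏ p ∈ n.primeFactors, p ^ n.factorization p :=
        (Nat.prod_factorization_pow_eq_self hn).symm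
    _ ∣ ∏ p ∈ n.primeFactors, p ^ n :=
        Finset.prod_dvd_prod_of_dvd _ _ fun p _ => pow_dvd_pow p (Nat.factorization_lt p hn).le
    _ = (∏ p ∈ n.primeFactors, p) ^ n := Finset.prod_pow _ _ _
    _ ∣ (∏ p ∈ P, p) ^ n := pow_dvd_pow_of_dvd (Finset.prod_dvd_prod_of_subset _ _ _ h) n

/-- If `|R|` divides a power of `N`, then a random element of `R` can be made from random elements
of `ZMod N`, and the collider with symbols in `ZMod N` simulates every automaton with random symbols
in `R`. -/
theorem stocSub_collider {N l : ℕ} [NeZero N] {Q R : Type*} [Finite Q] [Nonempty Q] [Finite R]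
    [Nonempty R] (A : SCA Q R) (hR : Nat.card R ∣ N ^ l) :
    ∃ (m₁ m₂ t₁ t₂ : ℕ+) (z₁ z₂ : ℤ),
      StocSub (A.rescaling m₁ t₁ z₁) ((collider (ZMod N)).rescaling m₂ t₂ z₂) := by
  obtain ⟨dec, hdec⟩ := exists_preservesUniform (S := Fin l → ZMod N) (S' := R) (by
    simpa using hR)
  -- after a translation by `b`, all neighbors are on the right, at distance at most `2 * b`
  obtain ⟨b, hb⟩ : ∃ b : ℕ, ∀ v ∈ A.V ∪ A.V', |v| ≤ b := by
    refine ⟨(A.V ∪ A.V').sup Int.natAbs, fun v hv => ?_⟩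
    rw [Int.abs_eq_natAbs]
    exact_mod_cast Finset.le_sup (f := Int.natAbs) hv
  have hlt : ∀ v ∈ A.V ∪ A.V', (b + v).toNat < 2 * b + 1 := fun v hv => by
    have := abs_le.1 (hb v hv)
    omega
  have hpos : ∀ v ∈ A.V ∪ A.V', ((b + v).toNat : ℤ) = b + v := fun v hv => by
    have := abs_le.1 (hb v hv)
    omega
  let φ : (Fin (2 * b + 1) → (Fin (1 : ℕ+) → Q) × (Fin l → ZMod N)) → Fin (1 : ℕ+) → Q :=
    fun g _ => A.f (fun v => (g ⟨(b + v : ℤ).toNat, hlt v (Finset.mem_union_left _ v.2)⟩).1 0)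
      fun v => dec (g ⟨(b + v : ℤ).toNat, hlt v (Finset.mem_union_right _ v.2)⟩).2
  obtain ⟨m, t, i, κ, hi, hκ, hsim⟩ := exists_collider_simulation φ
  let diag : R → Fin (1 : ℕ+) → Fin (1 : ℕ+) → R := fun r _ _ => r
  have hdiag : Function.Bijective diag :=
    ⟨fun _ _ h => congrFun (congrFun h 0) 0, fun x => ⟨x 0 0, by
      funext j j'
      obtain rfl : j = 0 := Subsingleton.elim (α := Fin 1) _ _
      obtain rfl : j' = 0 := Subsingleton.elim (α := Fin 1) _ _
      rfl⟩⟩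
  refine ⟨1, m, 1, t, b, 0, stocSub_of_global_eq hi
    ((preservesUniform_of_bijective hdiag).comp (hdec.comp (preservesUniform_entries hκ)))
    fun q s => ?_⟩
  rw [hsim]
  congr 1
  funext z
  rw [rescaling_one_global]
  funext j
  simp only [φ]
  congr 1
  · funext v
    rw [hpos v (Finset.mem_union_left _ v.2)]
  · funext v
    rw [hpos v (Finset.mem_union_right _ v.2)]
    rfl

end SCA

theorem mainTheorem11 (P : Finset ℕ) (hP : ∀ p ∈ P, p.Prime) :
    ∃ (Q_U R_U : Type) (_ : Finite Q_U) (_ : Nonempty Q_U) (_ : Finite R_U) (_ : Nonempty R_U)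
      (U : SCA Q_U R_U), U.IsCorrelationFree ∧
        ∀ (Q R : Type*) [Finite Q] [Nonempty Q] [Finite R] [Nonempty R] (A : SCA Q R),
          (Nat.card R).primeFactors ⊆ P → A.StocSimInj U ∧ A.StocSimMix U := by
  have : NeZero (∏ p ∈ P, p) := ⟨Finset.prod_ne_zero_iff.2 fun p hp => (hP p hp).ne_zero⟩
  refine ⟨SCA.Cell (ZMod (∏ p ∈ P, p)), ZMod (∏ p ∈ P, p), inferInstance, inferInstance,
    inferInstance, inferInstance, SCA.collider _, rfl, fun Q R _ _ _ _ A hR => ?_⟩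
  obtain ⟨m₁, m₂, t₁, t₂, z₁, z₂, h⟩ :=
    SCA.stocSub_collider A (SCA.dvd_prod_pow Nat.card_pos.ne' hR)
  exact ⟨⟨m₁, m₂, t₁, t₂, z₁, z₂, h⟩, ⟨m₁, m₂, t₁, t₂, z₁, z₂, h.stocMix⟩⟩
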